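/- **Communication model.** Processors are fully connected and communicate in synchronous rounds; in one round a processor sends a message to at most one processor and receives a message from at most one processor. A communication schedule with $C_1$ rounds, in which at most $b_i$ symbols are sent between two processors in round $i$, has cost $C_1\alpha+C_2\beta$ with $C_2=\sum_{i=1}^{C_1} b_i$, where $\alpha\ge 0$ and $\beta>0$ are constants. **Uncoded FFT.** Let $N=N_1N_2$ with $K\mid N_1$ and $K\mid N_2$. In the transpose algorithm for the $N$-point FFT on $K$ processors, the input is arranged in an $N_1\times N_2$ matrix $X$, of which the $i$-th processor stores the $i$-th of $K$ blocks of consecutive columns. The data are transposed (every processor obtains its row block), row-wise FFTs are computed, the data are transposed back (every processor obtains its column block), multiplied by twiddle factors, and column-wise FFTs are computed. Let $C_{\mathrm{unc}}$ be the communication cost of this algorithm in the minimum-round regime, that is, the least total cost of the two transposes when each is an all-to-all exchange, in which processors forward stored symbols, with exactly $\lceil\log_2K\rceil$ rounds. **Coded FFT.** In the coded algorithm there are $P\ge K$ processors, $K$ systematic and $P-K$ parity ones, and the communication overhead of coding is the cost of encoding the row-wise parity symbols: from the twiddled $N_1\times N_2$ matrix $Y=T_N\circ(XF_{N_2})$,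 where $F_{N_2}$ is the DFT matrix, $T_N$ is the matrix of twiddle factors and $\circ$ is the entrywise product, with the $i$-th column block of $Y$ stored at the $i$-th systematic processor, every processor has to obtain its column block of $Y G_2$, where $G_2=[I_K\ \mathcal P]\otimes I_{N_2/K}$ and $[I_K\ \mathcal P]$ is the generator matrix of a $(P,K)$ systematic MDS code over $\mathbb C$. During the encoding, processors may send linear combinations of the symbols they store. **Theorem.** Consider a sequence of such parameters $(K,P,N_1,N_2)$ and codes with $K\to\infty$, $K=o(\sqrt N)$ and $P-K=o(\log_2K)$, and fix $\alpha\ge0$, $\beta>0$. Then the communication overhead of coding is negligible compared to the communication cost of the uncoded FFT. Precisely: 1. The encoding can be performed by schedules whose cost $C_{\mathrm{enc}}$ satisfies $C_{\mathrm{enc}}=o(C_{\mathrm{unc}})$ and, for all sufficiently late members of the sequence, $$C_{\mathrm{enc}}\le 2\Big(\lceil\log_2K\rceil\alpha+(P-K)\frac NK\beta\Big).$$ 2. $2\big(\lceil\log_2K\rceil\alpha+(P-K)\frac NK\beta\big)=o(C_{\mathrm{unc}})$. 3. $C_{\mathrm{unc}}\sim 2\big(\lceil\log_2K\rceil\alpha+\frac{N}{2K}\log_2K\,\beta\big)$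 and $C_{\mathrm{unc}}\sim\frac NK\log_2K\,\beta$. 4. For every member of the sequence, the two cost expressions compare as follows: $$2\Big(\lceil\log_2K\rceil\alpha+(P-K)\frac NK\beta\Big)<2\Big(\lceil\log_2K\rceil\alpha+\frac{N}{2K}\log_2K\,\beta\Big)\iff P-K<\frac{\log_2K}{2}.$$ -/

import Mathlib

open Filter Topology

noncomputable section

namespace CodedFFT

/-! ### The communication model

Fully connected network of processors `ν`, one duplex port per processor, synchronous rounds. -/

/-- A communication schedule: in round `t < rounds` processor `u` sends to processor `v` the finite
set `msg t u v` of symbols. In one round a processor sends to at most one processor and receives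
from at most one processor. -/
structure Schedule (ν σ : Type) where
  rounds : ℕ
  msg : ℕ → ν → ν → Finset σ
  send_one : ∀ t u v w, (msg t u v).Nonempty → (msg t u w).Nonempty → v = w
  receive_one : ∀ t u v w, (msg t u w).Nonempty → (msg t v w).Nonempty → u = v

namespace Schedule

variable {ν σ : Type}

/-- The symbols stored at a processor after `t` rounds: those stored initially and those received. -/
def holds (S : Schedule ν σ) (init : ν → Set σ) : ℕ → ν → Set σ
  | 0, v => init v
  | t + 1, v => holds S init t v ∪ {s | ∃ u, s ∈ S.msg t u v}

/-- `S` performs a communication task. Processor `v` starts with the symbols `init v` and has to be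
able to produce the symbols `goal v` at the end; `comp A` is the set of symbols which a processor
that stores `A` can produce without communication. Only such symbols may be sent. -/
def Performs (S : Schedule ν σ) (comp : Set σ → Set σ) (init goal : ν → Set σ) : Prop :=
  (∀ t < S.rounds, ∀ u v, (S.msg t u v : Set σ) ⊆ comp (S.holds init t u)) ∧
    ∀ v, goal v ⊆ comp (S.holds init S.rounds v)

/-- The largest number of symbols communicated between two processors in round `t`. -/
def roundSize [Fintype ν] (S : Schedule ν σ) (t : ℕ) : ℕ :=
  Finset.univ.sup fun e : ν × ν => (S.msg t e.1 e.2).card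

/-- The cost `C₁ α + C₂ β`: `C₁` is the number of rounds and `C₂` the number of symbols
communicated in sequence. -/
def cost [Fintype ν] (S : Schedule ν σ) (α β : ℝ) : ℝ :=
  (S.rounds : ℝ) * α + ((∑ t ∈ Finset.range S.rounds, S.roundSize t : ℕ) : ℝ) * β

end Schedule

/-! ### The uncoded distributed FFT

`N = N₁ N₂` with `N₁ = K n₁` and `N₂ = K n₂`. Row `n₁ i + s` of an `N₁ × N₂` matrix is indexed by
`(i, s)`, so `i` is the number of its row block; likewise for columns. -/

/-- The positions of an `N₁ × N₂` matrix. -/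
abbrev Pos (K n₁ n₂ : ℕ) : Type := (Fin K × Fin n₁) × (Fin K × Fin n₂)

/-- Processor `i` stores the `i`-th of `K` blocks of consecutive columns. -/
def colWise (K n₁ n₂ : ℕ) (i : Fin K) : Set (Pos K n₁ n₂) := {e | e.2.1 = i}

/-- Processor `i` stores the `i`-th of `K` blocks of consecutive rows. -/
def rowWise (K n₁ n₂ : ℕ) (i : Fin K) : Set (Pos K n₁ n₂) := {e | e.1.1 = i}

/-- The costs of the two transposes of the uncoded algorithm (columns to rows before the first FFT
step, rows to columns before the second one). Each is an all-to-all exchange in which `K` processors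
forward stored symbols, and uses the minimum number `⌈log₂ K⌉` of rounds. -/
def uncodedCosts (K n₁ n₂ : ℕ) (α β : ℝ) : Set ℝ :=
  {c | ∃ S T : Schedule (Fin K) (Pos K n₁ n₂),
    S.rounds = ⌈Real.logb 2 K⌉₊ ∧ S.Performs id (colWise K n₁ n₂) (rowWise K n₁ n₂) ∧
    T.rounds = ⌈Real.logb 2 K⌉₊ ∧ T.Performs id (rowWise K n₁ n₂) (colWise K n₁ n₂) ∧
    c = S.cost α β + T.cost α β}

/-- The communication cost of the uncoded distributed FFT in the minimum-round regime. -/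
def uncodedCost (K n₁ n₂ : ℕ) (α β : ℝ) : ℝ := sInf (uncodedCosts K n₁ n₂ α β)

/-! ### The data of the second FFT step -/

/-- The input vectors of length `N`. -/
abbrev Input (K n₁ n₂ : ℕ) : Type := Fin ((K * n₂) * (K * n₁)) → ℂ

/-- The input arranged in an `N₁ × N₂` matrix, column after column. -/
def arrange {K n₁ n₂ : ℕ} (x : Input K n₁ n₂) : Matrix (Fin K × Fin n₁) (Fin K × Fin n₂) ℂ :=
  Matrix.of fun a c => x (finProdFinEquiv (finProdFinEquiv c, finProdFinEquiv a))

/-- The primitive `N`-th root of unity `exp(-2πi/N)`. -/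
def omega (N : ℕ) : ℂ := Complex.exp (-2 * Real.pi * Complex.I / N)

/-- The DFT matrix of size `K n`, with rows and columns indexed in blocks. -/
def dft (K n : ℕ) : Matrix (Fin K × Fin n) (Fin K × Fin n) ℂ :=
  Matrix.of fun a c =>
    omega (K * n) ^ ((finProdFinEquiv a : Fin (K * n)).val * (finProdFinEquiv c : Fin (K * n)).val)

/-- The matrix of twiddle factors. -/
def twiddle (K n₁ n₂ : ℕ) : Matrix (Fin K × Fin n₁) (Fin K × Fin n₂) ℂ :=
  Matrix.of fun a c =>
    omega ((K * n₁) * (K * n₂)) ^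
      ((finProdFinEquiv a : Fin (K * n₁)).val * (finProdFinEquiv c : Fin (K * n₂)).val)

/-- The matrix `Y`: row-wise FFTs of the arranged input, multiplied by the twiddle factors. -/
def secondStepData {K n₁ n₂ : ℕ} (x : Input K n₁ n₂) :
    Matrix (Fin K × Fin n₁) (Fin K × Fin n₂) ℂ :=
  Matrix.hadamard (twiddle K n₁ n₂) (arrange x * dft K n₂)

/-! ### Encoding with a systematic MDS code -/

/-- The `K × (K + r)` matrix `[I 𝒫]`. -/
def generator {K r : ℕ} (Q : Matrix (Fin K) (Fin r) ℂ) : Matrix (Fin K) (Fin K ⊕ Fin r) ℂ :=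
  Matrix.fromCols 1 Q

/-- The systematic code generated by `[I 𝒫]` is maximum distance separable: with `P = K + r`, every
nonzero codeword has weight at least `P - K + 1`. -/
def IsMDS {K r : ℕ} (Q : Matrix (Fin K) (Fin r) ℂ) : Prop :=
  ∀ u : Fin K → ℂ, u ≠ 0 → r + 1 ≤ hammingNorm (Matrix.vecMul u (generator Q))

/-- The encoded matrix `Y G₂` with `G₂ = [I 𝒫] ⊗ I`. -/
def encoded {K r n₁ n₂ : ℕ} (Q : Matrix (Fin K) (Fin r) ℂ) (x : Input K n₁ n₂) :
    Matrix (Fin K × Fin n₁) ((Fin K ⊕ Fin r) × Fin n₂) ℂ :=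
  secondStepData x * Matrix.kroneckerMap (· * ·) (generator Q) (1 : Matrix (Fin n₂) (Fin n₂) ℂ)

/-- Before the encoding, the `i`-th systematic processor stores the `i`-th column block of `Y` and
the parity processors store nothing. A symbol is a function of the input vector. -/
def beforeEncoding (K r n₁ n₂ : ℕ) : Fin K ⊕ Fin r → Set (Input K n₁ n₂ → ℂ)
  | Sum.inl i => {f | ∃ a s, f = fun x => secondStepData x a (i, s)}
  | Sum.inr _ => ∅

/-- After the encoding, every processor has its column block of `Y G₂`. -/
def afterEncoding {K r : ℕ} (n₁ n₂ : ℕ) (Q : Matrix (Fin K) (Fin r) ℂ) (p : Fin K ⊕ Fin r) :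
    Set (Input K n₁ n₂ → ℂ) :=
  {f | ∃ a s, f = fun x => encoded Q x a (p, s)}

/-- `S` encodes the row-wise parity symbols; processors may send linear combinations of the symbols
they store. -/
def Encodes {K r n₁ n₂ : ℕ} (Q : Matrix (Fin K) (Fin r) ℂ)
    (S : Schedule (Fin K ⊕ Fin r) (Input K n₁ n₂ → ℂ)) : Prop :=
  S.Performs (fun A => (Submodule.span ℂ A : Set (Input K n₁ n₂ → ℂ)))
    (beforeEncoding K r n₁ n₂) (afterEncoding n₁ n₂ Q)

/-! ### The two costs that are compared -/

/-- `2 (⌈log₂ K⌉ α + (P - K) (N / K) β)`. -/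
def encodingBound (N K P : ℕ) (α β : ℝ) : ℝ :=
  2 * ((⌈Real.logb 2 K⌉₊ : ℝ) * α + ((P : ℝ) - K) * ((N : ℝ) / K) * β)

/-- `2 (⌈log₂ K⌉ α + (N / (2 K)) log₂ K β)`, for two transposes. -/
def transposeBound (N K : ℕ) (α β : ℝ) : ℝ :=
  2 * ((⌈Real.logb 2 K⌉₊ : ℝ) * α + (N : ℝ) / (2 * K) * Real.logb 2 K * β)

end CodedFFT

end

/-! Write `M = N / K = K n₁ n₂` and `R = ⌈log₂ K⌉`. Each transpose is an all-to-all exchange with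
`n₁ n₂` symbols per ordered pair of processors. The core of the proof is that `C₂` for one exchange
in `R` rounds is `(R / 2) M` up to a relative error `O(1 / √R)`.

Lower bound (`le_sum_roundSize`): a processor has at most one receiver per round, so the source of a
symbol and the set of rounds in which it moves determine its destination. There are only `2 ^ R ≤ 2
K` such sets for `K` destinations, so nearly all sets are needed, and a typical one has about `R /
2` elements. An exponential moment bound makes this precise. Upper bound: Bruck's algorithm
(`sum_roundSize_bruck_le`). As `M → ∞`, the `α` term is negligible and `C_unc ∼ M log₂ K β`.

For the encoding, partial parities are pipelined in chunks along a chain through all systematic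
processors (`exists_encodes_cost_le`). Its symbol count is `(P - K) M` plus lower order terms; these
and the round cost fit into the factor 2 of the bound once `n₁ n₂` is large, which is what `K =
o(√N)` says. Finally `P - K = o(log₂ K)` makes `(P - K) M` negligible against `M log₂ K`. -/

namespace CodedFFT

/-! ### Lower bound for all-to-all exchanges by forwarding. -/

namespace Schedule

variable {ν σ : Type}

open Classical in
/-- The processor to which `u` sends in round `t`, and `u` itself if it is silent. -/
noncomputable def next (S : Schedule ν σ) (t : ℕ) (u : ν) : ν :=
  if h : ∃ v, (S.msg t u v).Nonempty then h.choose else u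

lemma next_eq (S : Schedule ν σ) {t : ℕ} {u v : ν} (h : (S.msg t u v).Nonempty) :
    S.next t u = v := by
  have h' : ∃ v, (S.msg t u v).Nonempty := ⟨v, h⟩
  rw [next, dif_pos h']
  exact S.send_one t u _ _ h'.choose_spec h

/-- The position after `t` rounds of a token that starts at `u` and follows the messages of the
rounds in `A`. -/
noncomputable def walk (S : Schedule ν σ) (A : Finset ℕ) (u : ν) : ℕ → ν
  | 0 => u
  | t + 1 => if t ∈ A then S.next t (walk S A u t) else walk S A u t

lemma walk_congr (S : Schedule ν σ) {A A' : Finset ℕ} (u : ν) {t : ℕ}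
    (h : ∀ s < t, s ∈ A ↔ s ∈ A') : S.walk A u t = S.walk A' u t := by
  induction t with
  | zero => rfl
  | succ t ih =>
    simp only [walk, h t (Nat.lt_succ_self t), ih fun s hs => h s (hs.trans (Nat.lt_succ_self t))]

open Classical in
/-- The number of times the symbol `e` is sent in the first `t` rounds. -/
noncomputable def hops [Fintype ν] (S : Schedule ν σ) (e : σ) (t : ℕ) : ℕ :=
  ∑ s ∈ Finset.range t, ∑ u, ∑ v, if e ∈ S.msg s u v then 1 else 0

lemma hops_succ_of_mem [Fintype ν] (S : Schedule ν σ) {e : σ} {t : ℕ} {u v : ν}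
    (h : e ∈ S.msg t u v) : S.hops e t + 1 ≤ S.hops e (t + 1) := by
  classical
  rw [hops, hops, Finset.sum_range_succ]
  gcongr
  calc 1 = if e ∈ S.msg t u v then 1 else 0 := by rw [if_pos h]
    _ ≤ ∑ w, if e ∈ S.msg t u w then 1 else 0 :=
      Finset.single_le_sum (f := fun w => if e ∈ S.msg t u w then 1 else 0)
        (fun _ _ => Nat.zero_le _) (Finset.mem_univ v)
    _ ≤ _ := Finset.single_le_sum (f := fun u => ∑ w, if e ∈ S.msg t u w then 1 else 0)
        (fun _ _ => Nat.zero_le _) (Finset.mem_univ u)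

lemma hops_le_succ [Fintype ν] (S : Schedule ν σ) (e : σ) (t : ℕ) :
    S.hops e t ≤ S.hops e (t + 1) := by
  rw [hops, hops, Finset.sum_range_succ]
  exact Nat.le_add_right _ _

/-- A processor that holds a forwarded symbol is reached from its source by a walk that is not
longer than the number of times the symbol was sent. -/
lemma exists_walk [Fintype ν] (S : Schedule ν σ) (src : σ → ν)
    (hS : ∀ t < S.rounds, ∀ u v, (S.msg t u v : Set σ) ⊆ S.holds (fun i => {e | src e = i}) t u)
    (e : σ) (t : ℕ) (ht : t ≤ S.rounds) (v : ν)
    (hv : e ∈ S.holds (fun i => {e | src e = i}) t v) :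
    ∃ A ⊆ Finset.range t, S.walk A (src e) t = v ∧ A.card ≤ S.hops e t := by
  induction t generalizing v with
  | zero => exact ⟨∅, by simp, hv, by simp⟩
  | succ t ih =>
    -- Either the symbol was already at `v` and the token rests in round `t`, or it has just come
    -- from `u` and round `t` joins the set of moves.
    rcases hv with hv | ⟨u, hu⟩
    · obtain ⟨A, hA, hw, hc⟩ := ih (by omega) v hv
      refine ⟨A, hA.trans (Finset.range_subset_range.2 t.le_succ), ?_,
        hc.trans (S.hops_le_succ e t)⟩
      have : t ∉ A := fun h => by simpa using hA h
      simp [walk, this, hw]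
    · obtain ⟨A, hA, hw, hc⟩ := ih (by omega) u (hS t (by omega) u v hu)
      have htA : t ∉ A := fun h => by simpa using hA h
      refine ⟨insert t A, ?_, ?_, ?_⟩
      · rw [Finset.range_add_one]
        exact Finset.insert_subset_insert t hA
      · have : S.walk (insert t A) (src e) t = S.walk A (src e) t := by
          apply walk_congr
          intro s hs
          simp [hs.ne]
        simp only [walk, Finset.mem_insert_self, if_true, this, hw]
        exact S.next_eq ⟨e, hu⟩
      · rw [Finset.card_insert_of_notMem htA]
        exact (Nat.add_le_add_right hc 1).trans (S.hops_succ_of_mem hu)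

lemma card_msg_le_roundSize [Fintype ν] (S : Schedule ν σ) (t : ℕ) (u v : ν) :
    (S.msg t u v).card ≤ S.roundSize t :=
  Finset.le_sup (f := fun e : ν × ν => (S.msg t e.1 e.2).card) (Finset.mem_univ (u, v))

/-- By `send_one` at most one term of the sum is nonzero. -/
lemma sum_card_msg_le_roundSize [Fintype ν] (S : Schedule ν σ) (t : ℕ) (u : ν) :
    ∑ v, (S.msg t u v).card ≤ S.roundSize t := by
  by_cases h : ∃ v, (S.msg t u v).Nonempty
  · obtain ⟨v, hv⟩ := h
    rw [Finset.sum_eq_single v]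
    · exact S.card_msg_le_roundSize t u v
    · intro w _ hw
      by_contra hne
      exact hw (S.send_one t u w v (Finset.card_pos.1 (Nat.pos_of_ne_zero hne)) hv)
    · simp
  · push Not at h
    simp [h]

lemma sum_hops_le [Fintype ν] [Fintype σ] (S : Schedule ν σ) (t : ℕ) :
    ∑ e, S.hops e t ≤ Fintype.card ν * ∑ s ∈ Finset.range t, S.roundSize s := by
  classical
  simp only [hops]
  rw [Finset.sum_comm, Finset.mul_sum]
  refine Finset.sum_le_sum fun s _ => ?_
  rw [Finset.sum_comm]
  calc _ = ∑ u, ∑ v, (S.msg s u v).card := by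
        refine Finset.sum_congr rfl fun u _ => ?_
        rw [Finset.sum_comm]
        simp
    _ ≤ ∑ _u : ν, S.roundSize s := Finset.sum_le_sum fun u _ => S.sum_card_msg_le_roundSize s u
    _ = _ := by simp

/-- The generating function of the numbers of times the symbols of an all-to-all exchange are
sent. -/
lemma sum_pow_hops_le [Fintype ν] [Fintype σ] (S : Schedule ν σ) (src dst : σ → ν) (B : ℕ)
    (hB : ∀ i j, Nat.card {e // src e = i ∧ dst e = j} ≤ B)
    (hS : S.Performs id (fun i => {e | src e = i}) (fun i => {e | dst e = i}))
    (x : ℝ) (hx0 : 0 ≤ x) (hx1 : x ≤ 1) :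
    ∑ e, x ^ S.hops e S.rounds ≤ B * Fintype.card ν * (x + 1) ^ S.rounds := by
  classical
  have hwalk : ∀ e, ∃ A ⊆ Finset.range S.rounds,
      S.walk A (src e) S.rounds = dst e ∧ A.card ≤ S.hops e S.rounds := fun e =>
    S.exists_walk src hS.1 e S.rounds le_rfl (dst e) (hS.2 (dst e) rfl)
  choose A hA hw hc using hwalk
  set D : Finset (ν × Finset ℕ) := Finset.univ ×ˢ (Finset.range S.rounds).powerset
  -- The pair `p` fixes the end of the walk, so its fibre lies in a single source-destination class.
  have hfib : ∀ p : ν × Finset ℕ, (Finset.univ.filter fun e => (src e, A e) = p).card ≤ B := by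
    intro p
    refine le_trans ?_ (hB p.1 (S.walk p.2 p.1 S.rounds))
    rw [Nat.card_eq_fintype_card, Fintype.card_subtype]
    refine Finset.card_le_card fun e he => ?_
    simp only [Finset.mem_filter, Finset.mem_univ, true_and] at he ⊢
    subst he
    exact ⟨rfl, (hw e).symm⟩
  calc ∑ e, x ^ S.hops e S.rounds ≤ ∑ e, x ^ (A e).card :=
        Finset.sum_le_sum fun e _ => pow_le_pow_of_le_one hx0 hx1 (hc e)
    _ = ∑ p ∈ D, ∑ e with (src e, A e) = p, x ^ (A e).card := by
        rw [Finset.sum_fiberwise_of_maps_to]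
        intro e _
        simpa [D] using hA e
    _ = ∑ p ∈ D, ((Finset.univ.filter fun e => (src e, A e) = p).card : ℝ) * x ^ p.2.card := by
        refine Finset.sum_congr rfl fun p _ => ?_
        rw [← nsmul_eq_mul, ← Finset.sum_const]
        refine Finset.sum_congr rfl fun e he => ?_
        rw [← (Finset.mem_filter.1 he).2]
    _ ≤ ∑ p ∈ D, (B : ℝ) * x ^ p.2.card := by
        refine Finset.sum_le_sum fun p _ => ?_
        gcongr
        exact_mod_cast hfib p
    _ = B * Fintype.card ν * (x + 1) ^ S.rounds := by
        rw [Finset.sum_product]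
        have := Finset.sum_pow_mul_eq_add_pow x 1 (Finset.range S.rounds)
        simp only [one_pow, mul_one, Finset.card_range] at this
        simp only [← Finset.mul_sum, this, Finset.sum_const, Finset.card_univ, nsmul_eq_mul]
        ring

/-- In an all-to-all exchange with the minimum number of rounds a symbol is sent in nearly half of
the rounds, on average. -/
lemma le_sum_roundSize [Fintype ν] [Nonempty ν] [Fintype σ] (S : Schedule ν σ) (src dst : σ → ν)
    (B : ℕ)
    (hB : ∀ i j, Nat.card {e // src e = i ∧ dst e = j} = B)
    (hS : S.Performs id (fun i => {e | src e = i}) (fun i => {e | dst e = i}))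
    (hR : 2 ^ S.rounds ≤ 2 * Fintype.card ν) :
    ((S.rounds : ℝ) / 2 - 2 * √S.rounds) * (Fintype.card ν * B) ≤
      ((∑ t ∈ Finset.range S.rounds, S.roundSize t : ℕ) : ℝ) := by
  classical
  set R := S.rounds with hRdef
  set k : ℝ := (Fintype.card ν : ℝ) with hk
  have hkpos : 0 < k := by
    rw [hk]
    exact_mod_cast Fintype.card_pos
  rcases Nat.eq_zero_or_pos R with h0 | hRpos
  · simp [h0]
  have hRpos' : (0 : ℝ) < R := by exact_mod_cast hRpos
  have hq : 0 < √(R : ℝ) := Real.sqrt_pos.2 hRpos'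
  have hqq : √(R : ℝ) * √R = R := Real.mul_self_sqrt hRpos'.le
  set q := √(R : ℝ)
  have hcard : (Fintype.card σ : ℝ) = k * k * B := by
    have h1 : Fintype.card σ = ∑ p : ν × ν, B := by
      rw [← Finset.card_univ, Finset.card_eq_sum_card_fiberwise (f := fun e => (src e, dst e))
        (t := Finset.univ) (fun _ _ => by simp)]
      refine Finset.sum_congr rfl fun p _ => ?_
      rw [← hB p.1 p.2, Nat.card_eq_fintype_card, Fintype.card_subtype]
      congr 1
      ext e
      simp [Prod.ext_iff]
    rw [h1]
    simp [hk]
  -- `c` is the claimed average. The scale `θ = 1 / √R` keeps the second-order term `R θ² / 8`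
  -- constant, and the `2 √R` subtracted in `c` contributes `-2` to the exponent.
  set c : ℝ := R / 2 - 2 * q with hc
  set θ : ℝ := 1 / q with hθ
  have hθpos : 0 < θ := by positivity
  have hexp : ∑ e, Real.exp (-θ) ^ S.hops e R ≤ B * k * (Real.exp (-θ) + 1) ^ R :=
    S.sum_pow_hops_le src dst B (fun i j => (hB i j).le) hS _ (Real.exp_pos _).le
      (Real.exp_le_one_iff.2 (by linarith))
  have hcosh : Real.exp (-θ) + 1 ≤ 2 * Real.exp (-θ / 2 + θ ^ 2 / 8) := by
    have h := Real.cosh_le_exp_half_sq (θ / 2)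
    have h2 : Real.exp (-θ) + 1 = 2 * (Real.exp (-θ / 2) * Real.cosh (θ / 2)) := by
      rw [Real.cosh_eq]
      have e1 : Real.exp (-θ / 2) * Real.exp (θ / 2) = 1 := by
        rw [← Real.exp_add]; ring_nf; simp
      have e2 : Real.exp (-θ / 2) * Real.exp (-(θ / 2)) = Real.exp (-θ) := by
        rw [← Real.exp_add]; ring_nf
      linear_combination -e1 - e2
    rw [h2, Real.exp_add]
    have : θ ^ 2 / 8 = (θ / 2) ^ 2 / 2 := by ring
    rw [this]
    gcongr
  -- The minimality of the number of rounds enters here, as `2 ^ R ≤ 2 k`.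
  have hpow : (Real.exp (-θ) + 1) ^ R ≤ 2 * k * Real.exp (R * (-θ / 2 + θ ^ 2 / 8)) := by
    calc (Real.exp (-θ) + 1) ^ R ≤ (2 * Real.exp (-θ / 2 + θ ^ 2 / 8)) ^ R := by gcongr
      _ = 2 ^ R * Real.exp (R * (-θ / 2 + θ ^ 2 / 8)) := by rw [mul_pow, ← Real.exp_nat_mul]
      _ ≤ _ := by
        gcongr
        rw [hk]
        exact_mod_cast hR
  -- The tangent line of `exp` at 0 turns the exponential moment into a bound on the mean.
  have htan : ∑ e, (1 - θ * (S.hops e R - c)) ≤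
      Real.exp (θ * c) * ∑ e, Real.exp (-θ) ^ S.hops e R := by
    rw [Finset.mul_sum]
    refine Finset.sum_le_sum fun e _ => ?_
    rw [← Real.exp_nat_mul, ← Real.exp_add]
    have := Real.add_one_le_exp (θ * c + S.hops e R * -θ)
    linarith
  have hbound : Real.exp (θ * c) * ∑ e, Real.exp (-θ) ^ S.hops e R ≤ k * k * B := by
    calc Real.exp (θ * c) * ∑ e, Real.exp (-θ) ^ S.hops e R
        ≤ Real.exp (θ * c) * (B * k * (2 * k * Real.exp (R * (-θ / 2 + θ ^ 2 / 8)))) := by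
          refine mul_le_mul_of_nonneg_left (hexp.trans ?_) (Real.exp_pos _).le
          gcongr
      _ = (2 * Real.exp (θ * c + R * (-θ / 2 + θ ^ 2 / 8))) * (k * k * B) := by
          rw [Real.exp_add]; ring
      _ ≤ 1 * (k * k * B) := by
          refine mul_le_mul_of_nonneg_right ?_ (by positivity)
          -- The terms in `√R` cancel and leave `-2 + 1 / 8`; any value at most `-log 2` absorbs the
          -- factor 2.
          have : θ * c + R * (-θ / 2 + θ ^ 2 / 8) ≤ -1 := by
            have h1 : θ * q = 1 := by rw [hθ]; field_simp
            have h2 : θ ^ 2 * R = 1 := by rw [← hqq]; linear_combination (θ * q + 1) * h1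
            rw [hc]
            linarith
          have h3 := Real.exp_le_exp.2 this
          have h4 : Real.exp (-1) < 1 / 2 := lt_trans Real.exp_neg_one_lt_d9 (by norm_num)
          linarith
      _ = _ := one_mul _
  have hsum : ∑ e, (1 - θ * (S.hops e R - c)) =
      k * k * B - θ * (((∑ e, S.hops e R : ℕ) : ℝ) - c * (k * k * B)) := by
    rw [← hcard]
    push_cast
    simp only [mul_sub, Finset.sum_sub_distrib, ← Finset.mul_sum, Finset.sum_const,
      Finset.card_univ, nsmul_eq_mul]
    ring
  -- There are `k * k * B` symbols, so the constant terms of `hsum` and `hbound` cancel.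
  have hge : c * (k * k * B) ≤ ((∑ e, S.hops e R : ℕ) : ℝ) := by
    have : 0 ≤ θ * (((∑ e, S.hops e R : ℕ) : ℝ) - c * (k * k * B)) := by linarith
    have := nonneg_of_mul_nonneg_right this hθpos
    linarith
  have hle : ((∑ e, S.hops e R : ℕ) : ℝ) ≤
      k * ((∑ t ∈ Finset.range R, S.roundSize t : ℕ) : ℝ) := by
    rw [hk]
    exact_mod_cast S.sum_hops_le R
  have : k * (c * (k * B)) ≤ k * ((∑ t ∈ Finset.range R, S.roundSize t : ℕ) : ℝ) := by
    calc _ = c * (k * k * B) := by ring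
      _ ≤ _ := hge.trans hle
  exact le_of_mul_le_mul_left this hkpos

end Schedule

end CodedFFT

/-! ### Bruck's algorithm and the cost of the uncoded FFT. -/

namespace CodedFFT

/-- Subtracting `2 ^ t` clears the binary digit `t`, which injects the numbers with digit 1 into
those with digit 0 and stays below `K`. Hence `K` need not be a power of 2. -/
lemma two_mul_card_odd_div_le (K t : ℕ) :
    2 * ((Finset.range K).filter fun d => d / 2 ^ t % 2 = 1).card ≤ K := by
  have h1 := Finset.card_filter_add_card_filter_not (s := Finset.range K)
    (fun d => d / 2 ^ t % 2 = 1)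
  rw [Finset.card_range] at h1
  have key : ∀ d, d / 2 ^ t % 2 = 1 → 2 ^ t ≤ d := by
    intro d hd
    by_contra hlt
    rw [Nat.div_eq_of_lt (by omega)] at hd
    omega
  have h2 : ((Finset.range K).filter fun d => d / 2 ^ t % 2 = 1).card ≤
      ((Finset.range K).filter fun d => ¬ d / 2 ^ t % 2 = 1).card := by
    refine Finset.card_le_card_of_injOn (fun d => d - 2 ^ t) ?_ ?_
    · intro d hd
      simp only [Finset.mem_coe, Finset.mem_filter, Finset.mem_range] at hd ⊢
      obtain ⟨hdK, hd⟩ := hd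
      have h := key d hd
      have h3 : (d - 2 ^ t) / 2 ^ t = d / 2 ^ t - 1 := by
        simpa using Nat.sub_mul_div d (2 ^ t) 1
      rw [h3]
      exact ⟨(Nat.sub_le _ _).trans_lt hdK, by omega⟩
    · intro a ha b hb hab
      simp only [Finset.mem_coe, Finset.mem_filter, Finset.mem_range] at ha hb hab
      have := key a ha.2
      have := key b hb.2
      omega
  omega

section Bruck

variable {σ : Type} {K : ℕ} [NeZero K]

/-- The cyclic distance from the source of a symbol to its destination. -/
def offset (src dst : σ → Fin K) (e : σ) : ℕ := (dst e - src e).val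

/-- The processor where a symbol is before round `t` of Bruck's algorithm: in round `t` it moves on
by `2 ^ t` if this power occurs in the binary expansion of its offset. -/
def bruckPos (src dst : σ → Fin K) (e : σ) (t : ℕ) : Fin K :=
  src e + Fin.ofNat K (offset src dst e % 2 ^ t)

lemma bruckPos_succ_of_odd {src dst : σ → Fin K} {e : σ} {t : ℕ}
    (h : offset src dst e / 2 ^ t % 2 = 1) :
    bruckPos src dst e (t + 1) = bruckPos src dst e t + Fin.ofNat K (2 ^ t) := by
  rw [bruckPos, bruckPos, Nat.mod_pow_succ, h, mul_one, add_assoc]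
  congr 1
  ext
  simp [Fin.val_add]

lemma bruckPos_succ_of_not_odd {src dst : σ → Fin K} {e : σ} {t : ℕ}
    (h : ¬ offset src dst e / 2 ^ t % 2 = 1) :
    bruckPos src dst e (t + 1) = bruckPos src dst e t := by
  have h0 : offset src dst e / 2 ^ t % 2 = 0 := by omega
  rw [bruckPos, bruckPos, Nat.mod_pow_succ, h0, mul_zero, add_zero]

lemma bruckPos_zero (src dst : σ → Fin K) (e : σ) : bruckPos src dst e 0 = src e := by
  simp [bruckPos, Nat.mod_one]

lemma add_ofNat_offset (src dst : σ → Fin K) (e : σ) :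
    src e + Fin.ofNat K (offset src dst e) = dst e := by
  simp [offset]

lemma bruckPos_of_le (src dst : σ → Fin K) (e : σ) {t : ℕ} (h : K ≤ 2 ^ t) :
    bruckPos src dst e t = dst e := by
  have h' : offset src dst e < 2 ^ t := (dst e - src e).isLt.trans_le h
  rw [bruckPos, Nat.mod_eq_of_lt h', add_ofNat_offset]

variable [Fintype σ]

open Classical in
/-- Bruck's algorithm for the all-to-all exchange. -/
noncomputable def bruck (src dst : σ → Fin K) (R : ℕ) : Schedule (Fin K) σ where
  rounds := R
  msg t u v := Finset.univ.filter fun e => offset src dst e / 2 ^ t % 2 = 1 ∧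
    bruckPos src dst e t = u ∧ v = u + Fin.ofNat K (2 ^ t)
  send_one := by
    rintro t u v w ⟨e, he⟩ ⟨f, hf⟩
    simp only [Finset.mem_filter, Finset.mem_univ, true_and] at he hf
    rw [he.2.2, hf.2.2]
  receive_one := by
    rintro t u v w ⟨e, he⟩ ⟨f, hf⟩
    simp only [Finset.mem_filter, Finset.mem_univ, true_and] at he hf
    exact add_right_cancel (he.2.2.symm.trans hf.2.2)

lemma mem_holds_bruck (src dst : σ → Fin K) (R : ℕ) (e : σ) (t : ℕ) :
    e ∈ (bruck src dst R).holds (fun i => {e | src e = i}) t (bruckPos src dst e t) := by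
  induction t with
  | zero => exact (bruckPos_zero src dst e).symm
  | succ t ih =>
    by_cases h : offset src dst e / 2 ^ t % 2 = 1
    · refine Or.inr ⟨bruckPos src dst e t, ?_⟩
      simp [bruck, h, bruckPos_succ_of_odd h]
    · rw [bruckPos_succ_of_not_odd h]
      exact Or.inl ih

lemma bruck_performs (src dst : σ → Fin K) {R : ℕ} (hR : K ≤ 2 ^ R) :
    (bruck src dst R).Performs id (fun i => {e | src e = i}) (fun i => {e | dst e = i}) := by
  refine ⟨fun t _ u v e he => ?_, fun v e he => ?_⟩
  · have he' : bruckPos src dst e t = u := by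
      have := (Finset.mem_filter.1 (Finset.mem_coe.1 he)).2
      exact this.2.1
    rw [← he']
    exact mem_holds_bruck src dst R e t
  · have h := mem_holds_bruck src dst R e R
    rw [bruckPos_of_le src dst e hR, show dst e = v from he] at h
    exact h

/-- A message in round `t` carries only symbols whose offset has digit `t` equal to 1. At a given
processor each such offset leaves one possible source and destination, hence at most `B` symbols. -/
lemma two_mul_roundSize_bruck_le (src dst : σ → Fin K) (R B t : ℕ)
    (hB : ∀ i j, Nat.card {e // src e = i ∧ dst e = j} ≤ B) :
    2 * (bruck src dst R).roundSize t ≤ K * B := by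
  classical
  suffices h : (bruck src dst R).roundSize t ≤
      B * ((Finset.range K).filter fun d => d / 2 ^ t % 2 = 1).card by
    calc 2 * (bruck src dst R).roundSize t
        ≤ B * (2 * ((Finset.range K).filter fun d => d / 2 ^ t % 2 = 1).card) := by
          linarith
      _ ≤ B * K := Nat.mul_le_mul_left B (two_mul_card_odd_div_le K t)
      _ = _ := mul_comm _ _
  refine Finset.sup_le fun p _ => ?_
  obtain ⟨u, v⟩ := p
  refine Finset.card_le_mul_card_image_of_maps_to (f := offset src dst) ?_ B ?_
  · intro e he
    simp only [bruck, Finset.mem_filter, Finset.mem_univ, true_and] at he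
    simp only [Finset.mem_filter, Finset.mem_range]
    exact ⟨(dst e - src e).isLt, he.1⟩
  · intro d _
    set i : Fin K := u - Fin.ofNat K (d % 2 ^ t) with hi
    refine le_trans ?_ (hB i (i + Fin.ofNat K d))
    rw [Nat.card_eq_fintype_card, Fintype.card_subtype]
    refine Finset.card_le_card fun e he => ?_
    simp only [bruck, Finset.mem_filter, Finset.mem_univ, true_and] at he ⊢
    have hs : src e = i := by
      rw [hi, ← he.1.2.1, bruckPos, he.2, add_sub_cancel_right]
    exact ⟨hs, by rw [← hs, ← he.2, add_ofNat_offset]⟩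

lemma sum_roundSize_bruck_le (src dst : σ → Fin K) (R B : ℕ)
    (hB : ∀ i j, Nat.card {e // src e = i ∧ dst e = j} ≤ B) :
    ((∑ t ∈ Finset.range R, (bruck src dst R).roundSize t : ℕ) : ℝ) ≤ R / 2 * (K * B) := by
  have h : 2 * ∑ t ∈ Finset.range R, (bruck src dst R).roundSize t ≤ R * (K * B) := by
    rw [Finset.mul_sum]
    refine (Finset.sum_le_sum fun t _ => two_mul_roundSize_bruck_le src dst R B t hB).trans ?_
    simp
  have h' : (2 : ℝ) * ((∑ t ∈ Finset.range R, (bruck src dst R).roundSize t : ℕ) : ℝ) ≤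
      R * (K * B) := by exact_mod_cast h
  linarith

end Bruck

lemma card_le_two_pow_ceil_logb {K : ℕ} (hK : 0 < K) : K ≤ 2 ^ ⌈Real.logb 2 K⌉₊ := by
  have hK' : (0 : ℝ) < K := by exact_mod_cast hK
  have h : (K : ℝ) ≤ 2 ^ (⌈Real.logb 2 K⌉₊ : ℝ) :=
    (Real.logb_le_iff_le_rpow one_lt_two hK').1 (Nat.le_ceil _)
  rw [Real.rpow_natCast] at h
  exact_mod_cast h

/-- Needed for the lower bound: in the minimum-round regime there are few sets of rounds. -/
lemma two_pow_ceil_logb_le {K : ℕ} (hK : 0 < K) : 2 ^ ⌈Real.logb 2 K⌉₊ ≤ 2 * K := by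
  have hK' : (1 : ℝ) ≤ K := by exact_mod_cast hK
  have h : (2 : ℝ) ^ (⌈Real.logb 2 K⌉₊ : ℝ) ≤ 2 ^ (Real.logb 2 K + 1) :=
    Real.rpow_le_rpow_of_exponent_le one_le_two
      (Nat.ceil_lt_add_one (Real.logb_nonneg one_lt_two hK')).le
  rw [Real.rpow_natCast, Real.rpow_add two_pos, Real.rpow_one,
    Real.rpow_logb two_pos (by norm_num) (by linarith), mul_comm] at h
  exact_mod_cast h

lemma card_pos_blocks (K n₁ n₂ : ℕ) (i j : Fin K) :
    Nat.card {e : Pos K n₁ n₂ // e.2.1 = i ∧ e.1.1 = j} = n₁ * n₂ := by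
  let φ : {e : Pos K n₁ n₂ // e.2.1 = i ∧ e.1.1 = j} ≃ Fin n₁ × Fin n₂ :=
    { toFun := fun e => (e.1.1.2, e.1.2.2)
      invFun := fun p => ⟨((j, p.1), (i, p.2)), rfl, rfl⟩
      left_inv := by
        rintro ⟨⟨⟨a, b⟩, ⟨c, d⟩⟩, h1, h2⟩
        simp only at h1 h2
        subst h1 h2
        rfl
      right_inv := fun p => rfl }
  rw [Nat.card_congr φ]
  simp

/-- The two transposes are exchanges with source and destination swapped, so the one-exchange bounds
are doubled. Bruck's schedules also show that the infimum is over a nonempty set. -/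
lemma uncodedCost_bounds {K n₁ n₂ : ℕ} (hK : 0 < K) {α β : ℝ} (hα : 0 ≤ α) (hβ : 0 < β) :
    (⌈Real.logb 2 K⌉₊ - 4 * √⌈Real.logb 2 K⌉₊) * (K * (n₁ * n₂)) * β ≤
        uncodedCost K n₁ n₂ α β ∧
      uncodedCost K n₁ n₂ α β ≤
        2 * ⌈Real.logb 2 K⌉₊ * α + ⌈Real.logb 2 K⌉₊ * (K * (n₁ * n₂)) * β := by
  have : NeZero K := ⟨hK.ne'⟩
  set R := ⌈Real.logb 2 K⌉₊ with hR
  have hKR : K ≤ 2 ^ R := card_le_two_pow_ceil_logb hK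
  have hRK : 2 ^ R ≤ 2 * Fintype.card (Fin K) := by
    rw [Fintype.card_fin]
    exact two_pow_ceil_logb_le hK
  have hB : ∀ i j : Fin K, Nat.card {e : Pos K n₁ n₂ // e.2.1 = i ∧ e.1.1 = j} = n₁ * n₂ :=
    card_pos_blocks K n₁ n₂
  have hB' : ∀ i j : Fin K, Nat.card {e : Pos K n₁ n₂ // e.1.1 = i ∧ e.2.1 = j} = n₁ * n₂ := by
    intro i j
    rw [← hB j i]
    exact Nat.card_congr (Equiv.subtypeEquivRight fun e => and_comm)
  have hlow : ∀ c ∈ uncodedCosts K n₁ n₂ α β,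
      ((R : ℝ) - 4 * √R) * (K * (n₁ * n₂)) * β ≤ c := by
    rintro c ⟨S, T, hSR, hS, hTR, hT, rfl⟩
    have h1 := S.le_sum_roundSize (fun e => e.2.1) (fun e => e.1.1) (n₁ * n₂) hB hS
      (by rw [hSR]; exact hRK)
    have h2 := T.le_sum_roundSize (fun e => e.1.1) (fun e => e.2.1) (n₁ * n₂) hB' hT
      (by rw [hTR]; exact hRK)
    simp only [hSR, hTR, ← hR, Fintype.card_fin] at h1 h2
    simp only [Schedule.cost, hSR, hTR, ← hR]
    push_cast at h1 h2 ⊢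
    have h3 := mul_le_mul_of_nonneg_right h1 hβ.le
    have h4 := mul_le_mul_of_nonneg_right h2 hβ.le
    have h5 : 0 ≤ (R : ℝ) * α := by positivity
    linarith
  set S := bruck (fun e : Pos K n₁ n₂ => e.2.1) (fun e => e.1.1) R with hS
  set T := bruck (fun e : Pos K n₁ n₂ => e.1.1) (fun e => e.2.1) R with hT
  have hmem : S.cost α β + T.cost α β ∈ uncodedCosts K n₁ n₂ α β :=
    ⟨S, T, rfl, bruck_performs _ _ hKR, rfl, bruck_performs _ _ hKR, rfl⟩
  refine ⟨le_csInf ⟨_, hmem⟩ hlow, (csInf_le ⟨_, hlow⟩ hmem).trans ?_⟩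
  have h1 := sum_roundSize_bruck_le (fun e : Pos K n₁ n₂ => e.2.1) (fun e => e.1.1) R (n₁ * n₂)
    fun i j => (hB i j).le
  have h2 := sum_roundSize_bruck_le (fun e : Pos K n₁ n₂ => e.1.1) (fun e => e.2.1) R (n₁ * n₂)
    fun i j => (hB' i j).le
  have h3 := mul_le_mul_of_nonneg_right h1 hβ.le
  have h4 := mul_le_mul_of_nonneg_right h2 hβ.le
  have hSr : S.rounds = R := rfl
  have hTr : T.rounds = R := rfl
  rw [Schedule.cost, Schedule.cost, hSr, hTr]
  rw [← hS] at h3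
  rw [← hT] at h4
  push_cast at h3 h4 ⊢
  linarith

end CodedFFT

/-! ### Pipelined encoding along a chain. -/

namespace CodedFFT

lemma Schedule.holds_mono {ν σ : Type} (S : Schedule ν σ) (init : ν → Set σ) (v : ν) {s t : ℕ}
    (h : s ≤ t) : S.holds init s v ⊆ S.holds init t v := by
  induction t, h using Nat.le_induction with
  | base => exact subset_rfl
  | succ t _ ih => exact ih.trans Set.subset_union_left

lemma encoded_apply_inl {K r n₁ n₂ : ℕ} (Q : Matrix (Fin K) (Fin r) ℂ) (x : Input K n₁ n₂)
    (a : Fin K × Fin n₁) (i : Fin K) (s : Fin n₂) :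
    encoded Q x a (Sum.inl i, s) = secondStepData x a (i, s) := by
  simp [encoded, Matrix.mul_apply, generator, Fintype.sum_prod_type, Matrix.one_apply]

lemma encoded_apply_inr {K r n₁ n₂ : ℕ} (Q : Matrix (Fin K) (Fin r) ℂ) (x : Input K n₁ n₂)
    (a : Fin K × Fin n₁) (j : Fin r) (s : Fin n₂) :
    encoded Q x a (Sum.inr j, s) = ∑ i, Q i j * secondStepData x a (i, s) := by
  simp [encoded, Matrix.mul_apply, generator, Fintype.sum_prod_type, Matrix.one_apply, mul_comm]

/-- The entries of a column block. -/
abbrev Entry (K n₁ n₂ : ℕ) : Type := (Fin K × Fin n₁) × Fin n₂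

section Chain

variable {K r n₁ n₂ : ℕ} (Q : Matrix (Fin K) (Fin r) ℂ)

/-- The contribution of the systematic processors `0, …, k` to a parity symbol. -/
noncomputable def partialParity (k : ℕ) (j : Fin r) (e : Entry K n₁ n₂) : Input K n₁ n₂ → ℂ :=
  fun x => ∑ i with i.val ≤ k, Q i j * secondStepData x e.1 (i, e.2)

lemma partialParity_zero (hK : 0 < K) (j : Fin r) (e : Entry K n₁ n₂) :
    partialParity Q 0 j e =
      Q ⟨0, hK⟩ j • fun x => secondStepData x e.1 (⟨0, hK⟩, e.2) := by
  funext x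
  have : (Finset.univ.filter fun i : Fin K => i.val ≤ 0) = {⟨0, hK⟩} := by
    ext i
    simp [Fin.ext_iff]
  simp only [partialParity, this, Finset.sum_singleton]
  rfl

lemma partialParity_succ {k : ℕ} (hk : k + 1 < K) (j : Fin r) (e : Entry K n₁ n₂) :
    partialParity Q (k + 1) j e = partialParity Q k j e +
      Q ⟨k + 1, hk⟩ j • fun x => secondStepData x e.1 (⟨k + 1, hk⟩, e.2) := by
  funext x
  have : (Finset.univ.filter fun i : Fin K => i.val ≤ k + 1) =
      insert ⟨k + 1, hk⟩ (Finset.univ.filter fun i : Fin K => i.val ≤ k) := by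
    ext i
    simp only [Finset.mem_filter, Finset.mem_univ, true_and, Finset.mem_insert, Fin.ext_iff]
    omega
  simp [partialParity, this, add_comm]

lemma partialParity_last (j : Fin r) (a : Fin K × Fin n₁) (s : Fin n₂) :
    partialParity Q (K - 1) j (a, s) = fun x => encoded Q x a (Sum.inr j, s) := by
  funext x
  rw [encoded_apply_inr, partialParity, Finset.filter_true_of_mem]
  intro i _
  omega

/-- The successor of processor `i` on the chain `0 → 1 → ⋯ → K - 1 → j`. -/
def chainNext (i : Fin K) (j : Fin r) : Fin K ⊕ Fin r :=
  if h : i.val + 1 < K then Sum.inl ⟨i.val + 1, h⟩ else Sum.inr j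

/-- Every parity processor is preceded by `K - 1`. This gives the `receive_one` property. -/
lemma chainNext_injective {i i' : Fin K} {j j' : Fin r} (h : chainNext i j = chainNext i' j') :
    i = i' := by
  unfold chainNext at h
  ext
  split_ifs at h with h1 h2 h2
  · simpa using h
  · omega

/-- Chunk `s` of parity `j` passes processor `i` in round `j * C + s + i`, so round and processor
determine parity and chunk: a processor never has two messages to send. -/
lemma chunk_injective {C j j' s s' : ℕ} (hs : s < C) (hs' : s' < C) (h : j * C + s = j' * C + s') :
    j = j' ∧ s = s' := by
  have hC : 0 < C := by omega
  have hj : j = j' := by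
    have h' := congrArg (· / C) h
    simp only [Nat.add_comm (_ * C), Nat.add_mul_div_right _ _ hC, Nat.div_eq_of_lt hs,
      Nat.div_eq_of_lt hs', Nat.zero_add] at h'
    exact h'
  subst hj
  omega

open Classical in
/-- Pipelined encoding: the entries are divided into `C` chunks; the partial parities of the chunks
travel one after another down the chain of systematic processors and on to the parity
processor. -/
noncomputable def chainSchedule (g : Entry K n₁ n₂ → ℕ) (C : ℕ) (hg : ∀ e, g e < C) (T : ℕ) :
    Schedule (Fin K ⊕ Fin r) (Input K n₁ n₂ → ℂ) where
  rounds := T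
  msg t u v := (Finset.univ.filter fun p : Fin K × Fin r × Entry K n₁ n₂ =>
    u = Sum.inl p.1 ∧ v = chainNext p.1 p.2.1 ∧ p.2.1.val * C + g p.2.2 + p.1.val = t).image
      fun p => partialParity Q p.1 p.2.1 p.2.2
  send_one := by
    intro t u v w hv hw
    obtain ⟨p, hp⟩ := Finset.image_nonempty.1 hv
    obtain ⟨q, hq⟩ := Finset.image_nonempty.1 hw
    simp only [Finset.mem_filter, Finset.mem_univ, true_and] at hp hq
    have hi : p.1 = q.1 := Sum.inl_injective (hp.1.symm.trans hq.1)
    have hj : p.2.1 = q.2.1 :=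
      Fin.ext (chunk_injective (hg p.2.2) (hg q.2.2) (by have := hp.2.2; have := hq.2.2; grind)).1
    rw [hp.2.1, hq.2.1, hi, hj]
  receive_one := by
    intro t u v w hu hv
    obtain ⟨p, hp⟩ := Finset.image_nonempty.1 hu
    obtain ⟨q, hq⟩ := Finset.image_nonempty.1 hv
    simp only [Finset.mem_filter, Finset.mem_univ, true_and] at hp hq
    rw [hp.1, hq.1, chainNext_injective (hp.2.1.symm.trans hq.2.1)]

variable (g : Entry K n₁ n₂ → ℕ) (C : ℕ) (hg : ∀ e, g e < C) (T : ℕ)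

lemma partialParity_mem_msg (i : Fin K) (j : Fin r) (e : Entry K n₁ n₂) :
    partialParity Q i j e ∈ (chainSchedule Q g C hg T).msg (j.val * C + g e + i.val) (Sum.inl i)
      (chainNext i j) := by
  classical
  refine Finset.mem_image.2 ⟨(i, j, e), ?_, rfl⟩
  simp

lemma secondStepData_mem_holds (i : Fin K) (e : Entry K n₁ n₂) (t : ℕ) :
    (fun x => secondStepData x e.1 (i, e.2)) ∈
      (chainSchedule Q g C hg T).holds (beforeEncoding K r n₁ n₂) t (Sum.inl i) :=
  Schedule.holds_mono _ _ _ (Nat.zero_le t) ⟨e.1, e.2, rfl⟩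

/-- The preceding partial parity arrived one round earlier, and the processor adds its own stored
entry with its coefficient. -/
lemma partialParity_mem_span (k : ℕ) (hk : k < K) (j : Fin r) (e : Entry K n₁ n₂) :
    partialParity Q k j e ∈ Submodule.span ℂ ((chainSchedule Q g C hg T).holds
      (beforeEncoding K r n₁ n₂) (j.val * C + g e + k) (Sum.inl ⟨k, hk⟩)) := by
  cases k with
  | zero =>
    rw [partialParity_zero Q hk]
    exact Submodule.smul_mem _ _
      (Submodule.subset_span (secondStepData_mem_holds Q g C hg T _ e _))
  | succ k =>
    rw [partialParity_succ Q hk]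
    refine Submodule.add_mem _ (Submodule.subset_span (Or.inr ⟨Sum.inl ⟨k, by omega⟩, ?_⟩))
      (Submodule.smul_mem _ _
        (Submodule.subset_span (secondStepData_mem_holds Q g C hg T _ e _)))
    have h := partialParity_mem_msg Q g C hg T ⟨k, by omega⟩ j e
    have hn : chainNext (⟨k, by omega⟩ : Fin K) j = Sum.inl ⟨k + 1, hk⟩ := by
      simp [chainNext, hk]
    rwa [hn] at h

lemma chainSchedule_encodes (hK : 0 < K)
    (hT : ∀ (j : Fin r) (e : Entry K n₁ n₂), j.val * C + g e + K ≤ T) :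
    Encodes Q (chainSchedule Q g C hg T) := by
  classical
  refine ⟨?_, ?_⟩
  · intro t _ u v f hf
    obtain ⟨⟨i, j, e⟩, hp, rfl⟩ := Finset.mem_image.1 (Finset.mem_coe.1 hf)
    obtain ⟨rfl, -, rfl⟩ := (Finset.mem_filter.1 hp).2
    exact partialParity_mem_span Q g C hg T i.val i.isLt j e
  · rintro (i | j) f ⟨a, s, rfl⟩ <;> refine Submodule.subset_span ?_
    · simp only [encoded_apply_inl]
      exact secondStepData_mem_holds Q g C hg T i (a, s) _
    · rw [← partialParity_last]
      refine Schedule.holds_mono _ _ _ (hT j (a, s)) ?_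
      have h := partialParity_mem_msg Q g C hg T ⟨K - 1, by omega⟩ j (a, s)
      have hn : chainNext (⟨K - 1, by omega⟩ : Fin K) j = Sum.inr j := by
        simp only [chainNext]
        rw [dif_neg (by omega)]
      rw [hn] at h
      -- A symbol sent in round `t` is held after `t + 1` rounds.
      have hs : j.val * C + g (a, s) + K = j.val * C + g (a, s) + (K - 1) + 1 := by omega
      rw [hs]
      exact Or.inr ⟨_, h⟩

lemma roundSize_chainSchedule_le (b t : ℕ)
    (hb : ∀ c, (Finset.univ.filter fun e => g e = c).card ≤ b) :
    (chainSchedule Q g C hg T).roundSize t ≤ b := by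
  classical
  refine Finset.sup_le fun p _ => ?_
  obtain ⟨u, v⟩ := p
  refine Finset.card_image_le.trans ?_
  rcases Finset.eq_empty_or_nonempty (Finset.univ.filter
    fun p : Fin K × Fin r × Entry K n₁ n₂ => u = Sum.inl p.1 ∧ v = chainNext p.1 p.2.1 ∧
      p.2.1.val * C + g p.2.2 + p.1.val = t) with h0 | ⟨q, hq⟩
  · rw [h0]
    simp
  · simp only [Finset.mem_filter, Finset.mem_univ, true_and] at hq
    have key : ∀ p : Fin K × Fin r × Entry K n₁ n₂, u = Sum.inl p.1 →
        p.2.1.val * C + g p.2.2 + p.1.val = t →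
        p.1 = q.1 ∧ p.2.1 = q.2.1 ∧ g p.2.2 = g q.2.2 := by
      intro p hp1 hp2
      have hi : p.1 = q.1 := Sum.inl_injective (hp1.symm.trans hq.1)
      have hj := chunk_injective (hg p.2.2) (hg q.2.2)
        (show p.2.1.val * C + g p.2.2 = q.2.1.val * C + g q.2.2 by
          have := hq.2.2
          rw [hi] at hp2
          omega)
      exact ⟨hi, Fin.ext hj.1, hj.2⟩
    refine le_trans (Finset.card_le_card_of_injOn (fun p => p.2.2) ?_ ?_) (hb (g q.2.2))
    · intro p hp
      simp only [Finset.mem_coe, Finset.mem_filter, Finset.mem_univ, true_and] at hp ⊢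
      exact (key p hp.1 hp.2.2).2.2
    · intro p hp p' hp' h
      simp only [Finset.mem_coe, Finset.mem_filter, Finset.mem_univ, true_and] at hp hp'
      have h1 := key p hp.1 hp.2.2
      have h2 := key p' hp'.1 hp'.2.2
      exact Prod.ext (h1.1.trans h2.1.symm) (Prod.ext (h1.2.1.trans h2.2.1.symm) h)

lemma chainSchedule_cost_le (b : ℕ) (hb : ∀ c, (Finset.univ.filter fun e => g e = c).card ≤ b)
    (α : ℝ) {β : ℝ} (hβ : 0 ≤ β) :
    (chainSchedule Q g C hg T).cost α β ≤ T * α + T * b * β := by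
  rw [Schedule.cost]
  have h : ∑ t ∈ Finset.range T, (chainSchedule Q g C hg T).roundSize t ≤ T * b := by
    refine (Finset.sum_le_sum fun t _ => roundSize_chainSchedule_le Q g C hg T b t hb).trans ?_
    simp
  have h' : ((∑ t ∈ Finset.range T, (chainSchedule Q g C hg T).roundSize t : ℕ) : ℝ) ≤ T * b := by
    exact_mod_cast h
  have := mul_le_mul_of_nonneg_right h' hβ
  exact add_le_add le_rfl this

end Chain

/-- A finite type can be divided into chunks of at most `b` elements. -/
lemma exists_chunks (ε : Type) [Fintype ε] {b : ℕ} (hb : 0 < b) :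
    ∃ g : ε → ℕ, (∀ e, g e < Fintype.card ε / b + 1) ∧
      ∀ c, (Finset.univ.filter fun e => g e = c).card ≤ b := by
  classical
  let φ := Fintype.equivFin ε
  refine ⟨fun e => (φ e).val / b, fun e => Nat.lt_succ_of_le (Nat.div_le_div_right (φ e).isLt.le),
    fun c => ?_⟩
  calc _ ≤ (Finset.range b).card := by
        refine Finset.card_le_card_of_injOn (fun e => (φ e).val % b) ?_ ?_
        · intro e _
          simpa using Nat.mod_lt _ hb
        · intro e he e' he' h
          simp only [Finset.mem_coe, Finset.mem_filter, Finset.mem_univ, true_and] at he he' h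
          apply φ.injective
          ext
          rw [← Nat.div_add_mod (φ e).val b, ← Nat.div_add_mod (φ e').val b, he, he', h]
    _ = b := Finset.card_range b

/-- The encoding with pipelined chains costs at most `2 (P - K) (N / K) β`, as soon as the blocks
are large enough. -/
lemma exists_encodes_cost_le {K r n₁ n₂ : ℕ} (hK : 0 < K) (hn₁ : 0 < n₁) (hn₂ : 0 < n₂)
    (Q : Matrix (Fin K) (Fin r) ℂ) {α β : ℝ} (hα : 0 ≤ α) (hβ : 0 < β) :
    ∃ S : Schedule (Fin K ⊕ Fin r) (Input K n₁ n₂ → ℂ), Encodes Q S ∧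
      (3 * α + 2 * β ≤ Nat.sqrt (n₁ * n₂) * β →
        S.cost α β ≤ 2 * (r * (K * (n₁ * n₂)) * β)) := by
  -- Large chunks waste symbols while the pipeline fills, small ones cost rounds. With `b ≈ √(n₁
  -- n₂)` both overheads are `O(r M / b)`.
  set b := Nat.sqrt (n₁ * n₂) with hbdef
  have hb : 0 < b := Nat.sqrt_pos.2 (Nat.mul_pos hn₁ hn₂)
  obtain ⟨g, hg, hgb⟩ := exists_chunks (Entry K n₁ n₂) hb
  set C := Fintype.card (Entry K n₁ n₂) / b + 1 with hC
  -- Without parity processors the bound is zero, so not even the `K` rounds of pipeline filling are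
  -- allowed.
  rcases Nat.eq_zero_or_pos r with rfl | hr
  · refine ⟨chainSchedule Q g C hg 0, chainSchedule_encodes Q g C hg 0 hK fun j => j.elim0,
      fun _ => ?_⟩
    simpa using chainSchedule_cost_le Q g C hg 0 b hgb α hβ.le
  · refine ⟨chainSchedule Q g C hg (r * C + K), chainSchedule_encodes Q g C hg _ hK ?_,
      fun hlarge => (chainSchedule_cost_le Q g C hg _ b hgb α hβ.le).trans ?_⟩
    · intro j e
      have h1 : (j.val + 1) * C ≤ r * C := Nat.mul_le_mul_right C j.isLt
      have h2 := hg e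
      rw [Nat.succ_mul] at h1
      omega
    · have hb' : (1 : ℝ) ≤ b := by exact_mod_cast hb
      have hr' : (1 : ℝ) ≤ r := by exact_mod_cast hr
      have hK' : (1 : ℝ) ≤ K := by exact_mod_cast hK
      set M : ℝ := K * (n₁ * n₂) with hM
      have hCle : (C : ℝ) ≤ M / b + 1 := by
        rw [hC]
        push_cast
        gcongr
        refine Nat.cast_div_le.trans (le_of_eq ?_)
        simp [hM, mul_assoc]
      have hbb : (b : ℝ) * b ≤ n₁ * n₂ := by exact_mod_cast Nat.sqrt_le (n₁ * n₂)
      have hKb : (K : ℝ) * b ≤ M / b := by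
        rw [le_div_iff₀ (by linarith), mul_assoc, hM]
        gcongr
      have hMb : 0 ≤ M / b := by positivity
      set y : ℝ := r * (M / b) with hy
      have hKry : (r : ℝ) * (K * b) ≤ y := by rw [hy]; gcongr
      have hrb : (r : ℝ) * b ≤ y := by
        refine le_trans ?_ hKry
        gcongr
        nlinarith
      have hKb' : (K : ℝ) * b ≤ y := by
        refine le_trans ?_ hKry
        exact le_mul_of_one_le_left (by positivity) hr'
      have hyb : y * b = r * M := by rw [hy]; field_simp
      have hT : ((r * C + K : ℕ) : ℝ) ≤ y + r + K := by
        push_cast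
        have : (r : ℝ) * C ≤ r * (M / b + 1) := by gcongr
        rw [hy]
        linarith
      have hT1 : ((r * C + K : ℕ) : ℝ) ≤ 3 * y := by
        have h1 : (r : ℝ) ≤ r * b := le_mul_of_one_le_right (by linarith) hb'
        have h2 : (K : ℝ) ≤ K * b := le_mul_of_one_le_right (by linarith) hb'
        linarith
      have hT2 : ((r * C + K : ℕ) : ℝ) * b ≤ r * M + 2 * y := by
        calc _ ≤ (y + r + K) * b := by gcongr
          _ = y * b + r * b + K * b := by ring
          _ ≤ _ := by linarith
      have hy0 : 0 ≤ y := by positivity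
      calc _ ≤ 3 * y * α + (r * M + 2 * y) * β := by gcongr
        _ = r * M * β + y * (3 * α + 2 * β) := by ring
        -- `hlarge` bounds the whole overhead by a second copy of the main term, as `y * b = r * M`.
        _ ≤ r * M * β + y * (b * β) := by gcongr
        _ = r * M * β + y * b * β := by ring
        _ = _ := by rw [hyb]; ring

end CodedFFT

/-! ### Asymptotic comparison of the costs. -/

theorem mainTheorem5
    (K P n₁ n₂ N : ℕ → ℕ)
    (hK : ∀ m, 0 < K m) (hn₁ : ∀ m, 0 < n₁ m) (hn₂ : ∀ m, 0 < n₂ m)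
    (hKP : ∀ m, K m ≤ P m)
    (hN : ∀ m, N m = (K m * n₁ m) * (K m * n₂ m))
    (hK_top : Tendsto K atTop atTop)
    (hKN : (fun m => (K m : ℝ)) =o[atTop] fun m => Real.sqrt (N m))
    (hPK : (fun m => (P m : ℝ) - K m) =o[atTop] fun m => Real.logb 2 (K m))
    (Q : ∀ m, Matrix (Fin (K m)) (Fin (P m - K m)) ℂ)
    (hQ : ∀ m, CodedFFT.IsMDS (Q m))
    (α β : ℝ) (hα : 0 ≤ α) (hβ : 0 < β) :
    (∃ E : ∀ m, CodedFFT.Schedule (Fin (K m) ⊕ Fin (P m - K m))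
          (CodedFFT.Input (K m) (n₁ m) (n₂ m) → ℂ),
        (∀ m, CodedFFT.Encodes (Q m) (E m)) ∧
        (∀ᶠ m in atTop, (E m).cost α β ≤ CodedFFT.encodingBound (N m) (K m) (P m) α β) ∧
        (fun m => (E m).cost α β) =o[atTop]
          fun m => CodedFFT.uncodedCost (K m) (n₁ m) (n₂ m) α β) ∧
    ((fun m => CodedFFT.encodingBound (N m) (K m) (P m) α β) =o[atTop]
        fun m => CodedFFT.uncodedCost (K m) (n₁ m) (n₂ m) α β) ∧
    Asymptotics.IsEquivalent atTop
      (fun m => CodedFFT.uncodedCost (K m) (n₁ m) (n₂ m) α β)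
      (fun m => CodedFFT.transposeBound (N m) (K m) α β) ∧
    Asymptotics.IsEquivalent atTop
      (fun m => CodedFFT.uncodedCost (K m) (n₁ m) (n₂ m) α β)
      (fun m => (N m : ℝ) / K m * Real.logb 2 (K m) * β) ∧
    (∀ m, CodedFFT.encodingBound (N m) (K m) (P m) α β < CodedFFT.transposeBound (N m) (K m) α β ↔
        (P m : ℝ) - K m < Real.logb 2 (K m) / 2) := by
  have hKpos : ∀ m, (0 : ℝ) < K m := fun m => by exact_mod_cast hK m
  have hn₁pos : ∀ m, (0 : ℝ) < n₁ m := fun m => by exact_mod_cast hn₁ m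
  have hn₂pos : ∀ m, (0 : ℝ) < n₂ m := fun m => by exact_mod_cast hn₂ m
  set M : ℕ → ℝ := fun m => K m * (n₁ m * n₂ m) with hM
  have hMpos : ∀ m, 0 < M m := fun m => mul_pos (hKpos m) (mul_pos (hn₁pos m) (hn₂pos m))
  have hNK : ∀ m, (N m : ℝ) / K m = M m := by
    intro m
    have := (hKpos m).ne'
    rw [hN, hM]
    push_cast
    field_simp
  have hNK2 : ∀ m, (N m : ℝ) / (2 * K m) = M m / 2 := by
    intro m
    rw [← hNK, mul_comm, div_mul_eq_div_div]
  set L : ℕ → ℝ := fun m => Real.logb 2 (K m) with hL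
  set R : ℕ → ℝ := fun m => (⌈Real.logb 2 (K m)⌉₊ : ℝ) with hR
  have hR0 : ∀ m, 0 ≤ R m := fun m => Nat.cast_nonneg _
  have hKtop : Tendsto (fun m => (K m : ℝ)) atTop atTop :=
    tendsto_natCast_atTop_atTop.comp hK_top
  have hLtop : Tendsto L atTop atTop := (Real.tendsto_logb_atTop one_lt_two).comp hKtop
  have hLpos : ∀ᶠ m in atTop, 0 < L m := hLtop.eventually_gt_atTop 0
  have hMtop : Tendsto M atTop atTop := by
    refine tendsto_atTop_mono (fun m => ?_) hKtop
    have h1 : (1 : ℝ) ≤ n₁ m * n₂ m := by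
      exact_mod_cast Nat.mul_pos (hn₁ m) (hn₂ m)
    exact le_mul_of_one_le_right (hKpos m).le h1
  have hRL : Tendsto (fun m => R m / L m) atTop (𝓝 1) :=
    (tendsto_nat_ceil_div_atTop (R := ℝ)).comp hLtop
  have hsqrt : Tendsto (fun m => √(R m) / L m) atTop (𝓝 0) := by
    have h1 : Tendsto (fun m => √(R m / L m) / √(L m)) atTop (𝓝 0) :=
      (hRL.sqrt).div_atTop (Real.tendsto_sqrt_atTop.comp hLtop)
    refine h1.congr' ?_
    filter_upwards [hLpos] with m hm
    rw [Real.sqrt_div (hR0 m), div_div, Real.mul_self_sqrt hm.le]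
  have hRα : Tendsto (fun m => 2 * R m * α / (M m * L m * β)) atTop (𝓝 0) := by
    have h1 : Tendsto (fun m => R m / L m * (2 * α / β) / M m) atTop (𝓝 0) :=
      (hRL.mul_const _).div_atTop hMtop
    refine h1.congr' ?_
    filter_upwards [hLpos] with m hm
    have := (hMpos m).ne'
    field_simp
  have hFpos : ∀ᶠ m in atTop, 0 < M m * L m * β := by
    filter_upwards [hLpos] with m hm
    exact mul_pos (mul_pos (hMpos m) hm) hβ
  have hF : ∀ᶠ m in atTop, M m * L m * β ≠ 0 := hFpos.mono fun m hm => hm.ne'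
  have hunc : Asymptotics.IsEquivalent atTop
      (fun m => CodedFFT.uncodedCost (K m) (n₁ m) (n₂ m) α β) (fun m => M m * L m * β) := by
    rw [Asymptotics.isEquivalent_iff_tendsto_one hF]
    have hlow : Tendsto (fun m => R m / L m - 4 * (√(R m) / L m)) atTop (𝓝 1) := by
      simpa using hRL.sub (hsqrt.const_mul 4)
    have hupp : Tendsto (fun m => 2 * R m * α / (M m * L m * β) + R m / L m) atTop (𝓝 1) := by
      simpa using hRα.add hRL
    refine tendsto_of_tendsto_of_tendsto_of_le_of_le' hlow hupp ?_ ?_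
    · filter_upwards [hLpos, hFpos] with m hm hFm
      have h := (CodedFFT.uncodedCost_bounds (n₁ := n₁ m) (n₂ := n₂ m) (hK m) hα hβ).1
      rw [Pi.div_apply, le_div_iff₀ hFm]
      refine le_trans (le_of_eq ?_) h
      simp only [hR, hM]
      field_simp
    · filter_upwards [hLpos, hFpos] with m hm hFm
      have h := (CodedFFT.uncodedCost_bounds (n₁ := n₁ m) (n₂ := n₂ m) (hK m) hα hβ).2
      rw [Pi.div_apply, div_le_iff₀ hFm]
      refine h.trans (le_of_eq ?_)
      rw [add_mul, div_mul_cancel₀ _ hFm.ne']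
      simp only [hR, hM]
      field_simp
  have htr : Asymptotics.IsEquivalent atTop
      (fun m => CodedFFT.transposeBound (N m) (K m) α β) (fun m => M m * L m * β) := by
    rw [Asymptotics.isEquivalent_iff_tendsto_one hF]
    have h1 : Tendsto (fun m => 2 * R m * α / (M m * L m * β) + 1) atTop (𝓝 1) := by
      simpa using hRα.add_const 1
    refine h1.congr' ?_
    filter_upwards [hFpos] with m hFm
    rw [Pi.div_apply, eq_div_iff hFm.ne', add_mul, div_mul_cancel₀ _ hFm.ne',
      CodedFFT.transposeBound, hNK2]
    ring
  have henc : (fun m => CodedFFT.encodingBound (N m) (K m) (P m) α β) =o[atTop]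
      fun m => CodedFFT.uncodedCost (K m) (n₁ m) (n₂ m) α β := by
    refine Asymptotics.IsLittleO.trans_isTheta ?_ hunc.symm.isTheta
    rw [Asymptotics.isLittleO_iff_tendsto' (hF.mono fun m hm h => absurd h hm)]
    have h1 := hPK.tendsto_div_nhds_zero
    have h2 : Tendsto (fun m => 2 * R m * α / (M m * L m * β) + 2 * (((P m : ℝ) - K m) / L m))
        atTop (𝓝 0) := by
      simpa using hRα.add (h1.const_mul 2)
    refine h2.congr' ?_
    filter_upwards [hLpos, hFpos] with m hm hFm
    rw [eq_div_iff hFm.ne', add_mul, div_mul_cancel₀ _ hFm.ne', CodedFFT.encodingBound, hNK]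
    field_simp
    ring
  have hcost : ∀ m, ∃ S : CodedFFT.Schedule (Fin (K m) ⊕ Fin (P m - K m))
      (CodedFFT.Input (K m) (n₁ m) (n₂ m) → ℂ), CodedFFT.Encodes (Q m) S ∧
      (3 * α + 2 * β ≤ Nat.sqrt (n₁ m * n₂ m) * β →
        S.cost α β ≤ 2 * ((P m - K m : ℕ) * (K m * (n₁ m * n₂ m)) * β)) := fun m =>
    CodedFFT.exists_encodes_cost_le (hK m) (hn₁ m) (hn₂ m) (Q m) hα hβ
  choose E hE hEcost using hcost
  -- Since `√N = K √(n₁ n₂)`, the hypothesis `K = o(√N)` says that `n₁ n₂ → ∞`.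
  have hlarge : ∀ᶠ m in atTop, 3 * α + 2 * β ≤ Nat.sqrt (n₁ m * n₂ m) * β := by
    obtain ⟨k, hk⟩ := exists_nat_gt ((3 * α + 2 * β) / β)
    have hkpos : (0 : ℝ) < k := lt_of_le_of_lt (by positivity) hk
    have hb := hKN.bound (c := 1 / k) (by positivity)
    filter_upwards [hb] with m hm
    rw [Real.norm_of_nonneg (hKpos m).le, Real.norm_of_nonneg (Real.sqrt_nonneg _), hN] at hm
    have h1 : (((K m * n₁ m) * (K m * n₂ m) : ℕ) : ℝ) = (K m : ℝ) ^ 2 * (n₁ m * n₂ m) := by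
      push_cast
      ring
    rw [h1, Real.sqrt_mul (sq_nonneg _), Real.sqrt_sq (hKpos m).le, div_mul_eq_mul_div, one_mul,
      le_div_iff₀ hkpos] at hm
    have h2 : (k : ℝ) ≤ √(n₁ m * n₂ m) := le_of_mul_le_mul_left hm (hKpos m)
    have h3 : (k : ℝ) ^ 2 ≤ n₁ m * n₂ m := (Real.le_sqrt hkpos.le (by positivity)).1 h2
    have h4 : k ≤ Nat.sqrt (n₁ m * n₂ m) := Nat.le_sqrt'.2 (by exact_mod_cast h3)
    have h5 : (k : ℝ) ≤ Nat.sqrt (n₁ m * n₂ m) := by exact_mod_cast h4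
    have h6 := (div_lt_iff₀ hβ).1 hk
    have h7 := mul_le_mul_of_nonneg_right h5 hβ.le
    linarith
  have hEle : ∀ᶠ m in atTop,
      (E m).cost α β ≤ CodedFFT.encodingBound (N m) (K m) (P m) α β := by
    filter_upwards [hlarge] with m hm
    have h := hEcost m hm
    rw [Nat.cast_sub (hKP m)] at h
    rw [CodedFFT.encodingBound, hNK]
    have h0 : 0 ≤ R m * α := mul_nonneg (hR0 m) hα
    simp only [hR] at h0
    simp only [hM]
    linarith
  refine ⟨⟨E, hE, hEle, ?_⟩, henc, hunc.trans htr.symm, ?_, fun m => ?_⟩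
  · refine Asymptotics.IsBigO.trans_isLittleO (Asymptotics.IsBigO.of_bound 1 ?_) henc
    filter_upwards [hEle] with m hm
    have h0 : 0 ≤ (E m).cost α β := by
      rw [CodedFFT.Schedule.cost]
      positivity
    rw [Real.norm_of_nonneg h0, Real.norm_of_nonneg (h0.trans hm), one_mul]
    exact hm
  · simpa only [hNK] using hunc
  · rw [CodedFFT.encodingBound, CodedFFT.transposeBound, hNK, hNK2,
      mul_lt_mul_iff_right₀ two_pos, add_lt_add_iff_left, mul_lt_mul_iff_left₀ hβ,
      show M m / 2 * Real.logb 2 (K m) = Real.logb 2 (K m) / 2 * M m by ring,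
      mul_lt_mul_iff_left₀ (hMpos m)]
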